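/- A Borel probability measure $\lambda$ on a topological space $Y$ is called $\tau$-additive if $\lambda(\bigcup\mathcal G)=\sup_{U\in\mathcal G}\lambda(U)$ for every non-empty upwards directed family $\mathcal G$ of open subsets of $Y$; for measures on larger $\sigma$-algebras the same is required of directed families of measurable open sets with measurable union. Let $\mathcal M_\tau(Y)$ denote the set of all $\tau$-additive Borel probability measures on $Y$. Let $G$ be a topological group acting on a topological space $X$ via a (jointly) continuous action $\pi\colon G\times X\to X$, and let $\mu\in\mathcal M_\tau(G)$ and $\nu\in\mathcal M_\tau(X)$. Then there is a unique measure $\mu\times\nu$ on $G\times X$, defined on some $\sigma$-algebra containing all Borel sets of the product topology, which is complete, locally determined, effectively locally finite, $\tau$-additive, inner regular with respect to the Borel sets, and satisfies $(\mu\times\nu)(U\times V)=\mu(U)\,\nu(V)$ for all open $U\subseteq G$ and open $V\subseteq X$ (the $\tau$-additive product measure). For every Borel set $E\subseteq X$ the set $\pi^{-1}[E]$ lies in the domain of $\mu\times\nu$, and the formula $$(\mu\ast\nu)(E):=(\mu\times\nu)\big(\pi^{-1}[E]\big),\qquad E\subseteq X\text{ Borel},$$ defines a $\tau$-additive Borel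 probability measure $\mu\ast\nu$ on $X$. Here a measure is locally determined if every measurable set of infinite measure has a measurable subset of finite positive measure, and every set whose intersections with all measurable sets of finite measure are measurable is itself measurable; it is effectively locally finite if for every measurable set $E$ of positive measure there is a measurable open set $U$ of finite measure such that $E\cap U$ has positive measure. -/

import Mathlib

open MeasureTheory Set
open scoped ENNReal

/-- A measure `meas` on `Y` together with the σ-algebra `sigma` on which it is defined. -/
structure SigmaMeasure (Y : Type*) where
  sigma : MeasurableSpace Y
  meas : @Measure Y sigma

/-- τ-additivity: the measure of the union of a non-empty upwards directed family of
measurable open sets (with measurable union) is the supremum of the measures. -/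
def TauAdditive {Y : Type*} [TopologicalSpace Y] {m : MeasurableSpace Y}
    (lam : @Measure Y m) : Prop :=
  ∀ 𝒢 : Set (Set Y), 𝒢.Nonempty → DirectedOn (· ⊆ ·) 𝒢 →
    (∀ U ∈ 𝒢, IsOpen U ∧ MeasurableSet[m] U) → MeasurableSet[m] (⋃₀ 𝒢) →
      lam (⋃₀ 𝒢) = ⨆ U ∈ 𝒢, lam U

/-- Locally determined: semi-finite, and a set whose trace on every measurable set of finite
measure is measurable is itself measurable. -/
def LocallyDetermined {Y : Type*} {m : MeasurableSpace Y} (lam : @Measure Y m) : Prop :=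
  (∀ E : Set Y, MeasurableSet[m] E → lam E = ∞ →
    ∃ F ⊆ E, MeasurableSet[m] F ∧ 0 < lam F ∧ lam F < ∞) ∧
  ∀ A : Set Y, (∀ F : Set Y, MeasurableSet[m] F → lam F < ∞ → MeasurableSet[m] (A ∩ F)) →
    MeasurableSet[m] A

/-- Effectively locally finite: every measurable set of positive measure meets some measurable
open set of finite measure in a set of positive measure. -/
def EffectivelyLocallyFinite {Y : Type*} [TopologicalSpace Y] {m : MeasurableSpace Y}
    (lam : @Measure Y m) : Prop :=
  ∀ E : Set Y, MeasurableSet[m] E → 0 < lam E →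
    ∃ U : Set Y, IsOpen U ∧ MeasurableSet[m] U ∧ lam U < ∞ ∧ 0 < lam (E ∩ U)

/-- `M_τ(Y)`: the set of all τ-additive Borel probability measures on `Y`. -/
def MTau (Y : Type*) [TopologicalSpace Y] [MeasurableSpace Y] [BorelSpace Y] :
    Set (Measure Y) :=
  {μ | IsProbabilityMeasure μ ∧ TauAdditive μ}

/-- `P` is a τ-additive product of `μ` and `ν`: a complete, locally determined, effectively
locally finite, τ-additive topological measure on the product space, inner regular with respect
to the Borel sets of the product topology, and multiplicative on open rectangles. Its
σ-algebra contains the Borel sets of the product topology, which need not lie in the product of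
the two Borel σ-algebras. -/
structure IsTauProduct {Y Z : Type*} [TopologicalSpace Y] [MeasurableSpace Y]
    [TopologicalSpace Z] [MeasurableSpace Z] (μ : Measure Y) (ν : Measure Z)
    (P : SigmaMeasure (Y × Z)) : Prop where
  topological : borel (Y × Z) ≤ P.sigma
  complete : @Measure.IsComplete (Y × Z) P.sigma P.meas
  locallyDetermined : LocallyDetermined P.meas
  effectivelyLocallyFinite : EffectivelyLocallyFinite P.meas
  tauAdditive : TauAdditive P.meas
  innerRegular : @Measure.InnerRegularWRT (Y × Z) P.sigma P.meas
    (fun B => MeasurableSet[borel (Y × Z)] B) (fun E => MeasurableSet[P.sigma] E)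
  rectangle : ∀ (U : Set Y) (V : Set Z), IsOpen U → IsOpen V → P.meas (U ×ˢ V) = μ U * ν V

/-- The τ-additive product measure `μ × ν`, i.e. the measure characterized by `IsTauProduct`
(an arbitrary value if there is no such measure). -/
noncomputable def tauProd {Y Z : Type*} [TopologicalSpace Y] [MeasurableSpace Y]
    [TopologicalSpace Z] [MeasurableSpace Z] (μ : Measure Y) (ν : Measure Z) :
    SigmaMeasure (Y × Z) :=
  @Classical.epsilon (SigmaMeasure (Y × Z)) ⟨⟨⊤, 0⟩⟩ (IsTauProduct μ ν)

/-- The set function `(μ ∗ ν)(E) = (μ × ν)(π⁻¹[E])`, where `π (g, x) = g • x`. -/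
noncomputable def tauConv {G X : Type*} [SMul G X] [TopologicalSpace G] [MeasurableSpace G]
    [TopologicalSpace X] [MeasurableSpace X] (μ : Measure G) (ν : Measure X) (E : Set X) :
    ℝ≥0∞ :=
  (tauProd μ ν).meas ((fun p : G × X => p.1 • p.2) ⁻¹' E)

/-! ### τ-additivity and monotone convergence for directed families. -/

section TauAdditivity

variable {Y : Type*} [TopologicalSpace Y] [MeasurableSpace Y] [OpensMeasurableSpace Y]
  {μ : Measure Y}

/-! Existence comes from integrating fibre measures, `E ↦ ∫ ν(E_y) dμ(y)`. For open `W`,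
τ-additivity of `ν` makes `y ↦ ν(W_y)` lower semicontinuous, hence measurable, and a π-λ argument
reaches all Borel sets. The result is τ-additive by `TauAdditive.lintegral_iSup`, and its completion
is the required product.

For uniqueness, open rectangles determine a τ-additive finite measure on the Borel sets
(`TauAdditive.ext_of_prod`), while completeness and inner regularity force the full measure to be
the completion of its Borel part (`SigmaMeasure.eq_completion`). The convolution is the pushforward
of the product under the continuous action. -/

theorem TauAdditive.measure_iUnion (h : TauAdditive μ) {ι : Type*} [Nonempty ι]
    {U : ι → Set Y} (hd : Directed (· ⊆ ·) U) (ho : ∀ i, IsOpen (U i)) :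
    μ (⋃ i, U i) = ⨆ i, μ (U i) := by
  have := h (range U) (range_nonempty U) hd.directedOn_range
    (by rintro _ ⟨i, rfl⟩; exact ⟨ho i, (ho i).measurableSet⟩)
    (by rw [sUnion_range]; exact (isOpen_iUnion ho).measurableSet)
  rwa [sUnion_range, iSup_range] at this

/-- Indices whose measures tend to the supremum already exhaust the union up to a null set; this
reduces directed families to countable ones. -/
theorem TauAdditive.exists_seq_measure_diff_eq_zero [IsFiniteMeasure μ] (h : TauAdditive μ)
    {ι : Type*} [Nonempty ι] {U : ι → Set Y} (hd : Directed (· ⊆ ·) U)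
    (ho : ∀ i, IsOpen (U i)) :
    ∃ s : ℕ → ι, μ ((⋃ i, U i) \ ⋃ n, U (s n)) = 0 := by
  obtain ⟨u, -, hu, hmem⟩ := exists_seq_tendsto_sSup (range_nonempty fun i => μ (U i))
    (OrderTop.bddAbove _)
  choose s hs using hmem
  refine ⟨s, ?_⟩
  rw [measure_sdiff (iUnion_subset fun n => subset_iUnion U (s n))
    (MeasurableSet.iUnion fun n => (ho (s n)).measurableSet).nullMeasurableSet
    (measure_ne_top _ _), h.measure_iUnion hd ho, tsub_eq_zero_iff_le]
  refine le_of_tendsto' hu fun n => ?_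
  rw [← hs n]
  exact measure_mono (subset_iUnion (fun n => U (s n)) n)

/-- Monotone convergence for directed families of lower semicontinuous functions. -/
theorem TauAdditive.lintegral_iSup [IsFiniteMeasure μ] (h : TauAdditive μ)
    {ι : Type*} [Nonempty ι] {f : ι → Y → ℝ≥0∞} (hd : Directed (· ≤ ·) f)
    (hf : ∀ i, LowerSemicontinuous (f i)) :
    ∫⁻ y, ⨆ i, f i y ∂μ = ⨆ i, ∫⁻ y, f i y ∂μ := by
  classical
  refine le_antisymm ?_ (iSup_lintegral_le f)
  -- Each superlevel set at a rational height is a directed union of open sets, so countably many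
  -- indices suffice there. Over all heights, countably many functions attain the supremum almost
  -- everywhere.
  have hcount (q : ℚ) : ∃ s : ℕ → ι,
      μ ((⋃ i, f i ⁻¹' Ioi (Real.toNNReal q : ℝ≥0∞)) \
        ⋃ n, f (s n) ⁻¹' Ioi (Real.toNNReal q : ℝ≥0∞)) = 0 := by
    refine h.exists_seq_measure_diff_eq_zero (fun i j => ?_) fun i => (hf i).isOpen_preimage _
    obtain ⟨k, hik, hjk⟩ := hd i j
    exact ⟨k, fun y hy => lt_of_lt_of_le hy (hik y), fun y hy => lt_of_lt_of_le hy (hjk y)⟩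
  choose s hs using hcount
  have hae : ∀ᵐ y ∂μ, ⨆ i, f i y ≤ ⨆ F : Finset (ℚ × ℕ), ⨆ p ∈ F, f (s p.1 p.2) y := by
    have : ∀ᵐ y ∂μ, ∀ q : ℚ, y ∉ (⋃ i, f i ⁻¹' Ioi (Real.toNNReal q : ℝ≥0∞)) \
        ⋃ n, f (s q n) ⁻¹' Ioi (Real.toNNReal q : ℝ≥0∞) :=
      ae_all_iff.2 fun q => measure_eq_zero_iff_ae_notMem.1 (hs q)
    filter_upwards [this] with y hy
    -- Finite suprema turn the countable subfamily into a directed one; each is dominated by a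
    -- single `f i`.
    rw [← iSup_eq_iSup_finset (fun p : ℚ × ℕ => f (s p.1 p.2) y)]
    by_contra! hlt
    obtain ⟨q, -, hq, hq'⟩ := ENNReal.lt_iff_exists_rat_btwn.1 hlt
    obtain ⟨i, hi⟩ := lt_iSup_iff.1 hq'
    refine hy q ⟨mem_iUnion.2 ⟨i, hi⟩, fun hmem => ?_⟩
    obtain ⟨n, hn⟩ := mem_iUnion.1 hmem
    exact (hn.trans_le (le_iSup (fun p : ℚ × ℕ => f (s p.1 p.2) y) (q, n))).not_ge hq.le
  calc ∫⁻ y, ⨆ i, f i y ∂μ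
      ≤ ∫⁻ y, ⨆ F : Finset (ℚ × ℕ), ⨆ p ∈ F, f (s p.1 p.2) y ∂μ := lintegral_mono_ae hae
    _ = ⨆ F : Finset (ℚ × ℕ), ∫⁻ y, ⨆ p ∈ F, f (s p.1 p.2) y ∂μ := by
        refine MeasureTheory.lintegral_iSup_directed (fun F => ?_) (directed_of_isDirected_le ?_)
        · exact (Measurable.biSup _ F.countable_toSet fun p _ => (hf _).measurable).aemeasurable
        · exact fun F F' hF y => biSup_mono fun p hp => hF hp
    _ ≤ ⨆ i, ∫⁻ y, f i y ∂μ := by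
        refine iSup_le fun F => ?_
        obtain ⟨i, hi⟩ := hd.finset_le (F.image fun p => s p.1 p.2)
        exact (lintegral_mono fun y => iSup₂_le fun p hp =>
          hi _ (Finset.mem_image_of_mem _ hp) y).trans (le_iSup (fun i => ∫⁻ y, f i y ∂μ) i)

end TauAdditivity

/-! ### The iterated integral as a Borel measure on the product. -/

section BorelProduct

variable {Y Z : Type*} [TopologicalSpace Y] [TopologicalSpace Z] [MeasurableSpace Z]
  [BorelSpace Z] {ν : Measure Z}

/-- The open `V` with `U ×ˢ V ⊆ W` for some open `U ∋ y` are directed with union the fibre `W_y`.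
One of them has measure above `t`, and it lies in the fibre over every point of its `U`. -/
theorem TauAdditive.lowerSemicontinuous_measure_prodMk_preimage (hν : TauAdditive ν)
    {W : Set (Y × Z)} (hW : IsOpen W) :
    LowerSemicontinuous fun y => ν (Prod.mk y ⁻¹' W) := by
  intro y t ht
  let 𝒱 : Set (Set Z) := {V | IsOpen V ∧ ∃ U, IsOpen U ∧ y ∈ U ∧ U ×ˢ V ⊆ W}
  have hunion : ⋃₀ 𝒱 = Prod.mk y ⁻¹' W := by
    ext z
    constructor
    · rintro ⟨V, ⟨-, U, -, hy, hUV⟩, hz⟩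
      exact hUV ⟨hy, hz⟩
    · intro hz
      obtain ⟨U, V, hU, hV, hy, hz, hUV⟩ := isOpen_prod_iff.1 hW y z hz
      exact ⟨V, ⟨hV, U, hU, hy, hUV⟩, hz⟩
  have hsup : ν (⋃₀ 𝒱) = ⨆ V ∈ 𝒱, ν V := by
    refine hν 𝒱 ⟨∅, isOpen_empty, univ, isOpen_univ, mem_univ _, by simp⟩ ?_
      (fun V hV => ⟨hV.1, hV.1.measurableSet⟩)
      (isOpen_sUnion fun V hV => hV.1).measurableSet
    rintro V₁ ⟨hV₁, U₁, hU₁, hy₁, h₁⟩ V₂ ⟨hV₂, U₂, hU₂, hy₂, h₂⟩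
    refine ⟨V₁ ∪ V₂, ⟨hV₁.union hV₂, U₁ ∩ U₂, hU₁.inter hU₂, ⟨hy₁, hy₂⟩, ?_⟩,
      subset_union_left, subset_union_right⟩
    rintro ⟨a, b⟩ ⟨⟨ha₁, ha₂⟩, hb | hb⟩
    exacts [h₁ ⟨ha₁, hb⟩, h₂ ⟨ha₂, hb⟩]
  rw [hunion] at hsup
  simp only [hsup, lt_iSup_iff] at ht
  obtain ⟨V, ⟨-, U, hU, hy, hUV⟩, htV⟩ := ht
  filter_upwards [hU.mem_nhds hy] with y' hy'
  exact htV.trans_le (measure_mono fun z hz => hUV ⟨hy', hz⟩)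

variable [MeasurableSpace (Y × Z)] [BorelSpace (Y × Z)]

theorem measurable_prodMk_borel (y : Y) : Measurable (Prod.mk y : Z → Y × Z) :=
  (Continuous.prodMk_right y).measurable

variable [MeasurableSpace Y] [BorelSpace Y] {μ : Measure Y}

theorem TauAdditive.measurable_map_prodMk [IsProbabilityMeasure ν] (hν : TauAdditive ν) :
    Measurable fun y : Y => ν.map (Prod.mk y : Z → Y × Z) := by
  have hprob (y : Y) : IsProbabilityMeasure (ν.map (Prod.mk y : Z → Y × Z)) :=
    Measure.isProbabilityMeasure_map (measurable_prodMk_borel y).aemeasurable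
  refine Measurable.measure_of_isPiSystem_of_isProbabilityMeasure
    (BorelSpace.measurable_eq (α := Y × Z)) isPiSystem_isOpen fun W hW => ?_
  have hW : IsOpen W := hW
  simp_rw [Measure.map_apply (measurable_prodMk_borel _) hW.measurableSet]
  exact (hν.lowerSemicontinuous_measure_prodMk_preimage hW).measurable

/-- The measure `E ↦ ∫⁻ y, ν (E_y) ∂μ` on the Borel sets of the product topology. -/
noncomputable def borelProd (μ : Measure Y) (ν : Measure Z) : Measure (Y × Z) :=
  μ.bind fun y => ν.map (Prod.mk y)

variable [IsProbabilityMeasure ν]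

theorem TauAdditive.borelProd_apply (hν : TauAdditive ν) {E : Set (Y × Z)}
    (hE : MeasurableSet E) : borelProd μ ν E = ∫⁻ y, ν (Prod.mk y ⁻¹' E) ∂μ := by
  rw [borelProd, Measure.bind_apply hE hν.measurable_map_prodMk.aemeasurable]
  simp_rw [Measure.map_apply (measurable_prodMk_borel _) hE]

theorem TauAdditive.isProbabilityMeasure_borelProd [IsProbabilityMeasure μ]
    (hν : TauAdditive ν) : IsProbabilityMeasure (borelProd μ ν) :=
  ⟨by simp [hν.borelProd_apply MeasurableSet.univ]⟩

theorem TauAdditive.borelProd_prod (hν : TauAdditive ν) {U : Set Y} {V : Set Z}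
    (hU : IsOpen U) (hV : IsOpen V) : borelProd μ ν (U ×ˢ V) = μ U * ν V := by
  classical
  rw [hν.borelProd_apply (hU.prod hV).measurableSet]
  simp_rw [mk_preimage_prod_right_eq_if, measure_if]
  rw [lintegral_indicator hU.measurableSet, lintegral_const, Measure.restrict_apply_univ,
    mul_comm]

theorem TauAdditive.tauAdditive_borelProd [IsProbabilityMeasure μ] (hμ : TauAdditive μ)
    (hν : TauAdditive ν) : TauAdditive (borelProd μ ν) := by
  intro 𝒢 hne hd ho hU
  have := hne.to_subtype
  have hd' : Directed (· ⊆ ·) fun W : 𝒢 => (W : Set (Y × Z)) := hd.directed_val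
  have hfib : ∀ y, ν (Prod.mk y ⁻¹' ⋃₀ 𝒢) = ⨆ W : 𝒢, ν (Prod.mk y ⁻¹' W) := by
    intro y
    rw [sUnion_eq_iUnion, preimage_iUnion]
    refine hν.measure_iUnion (fun W₁ W₂ => ?_)
      fun W => (ho W W.2).1.preimage (Continuous.prodMk_right y)
    obtain ⟨W, h₁, h₂⟩ := hd' W₁ W₂
    exact ⟨W, preimage_mono h₁, preimage_mono h₂⟩
  rw [hν.borelProd_apply hU, iSup_subtype']
  simp_rw [hfib]
  rw [hμ.lintegral_iSup]
  · exact iSup_congr fun W => (hν.borelProd_apply (ho W W.2).2).symm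
  · intro W₁ W₂
    obtain ⟨W, h₁, h₂⟩ := hd' W₁ W₂
    exact ⟨W, fun y => measure_mono (preimage_mono h₁), fun y => measure_mono (preimage_mono h₂)⟩
  · exact fun W => hν.lowerSemicontinuous_measure_prodMk_preimage (ho W W.2).1

end BorelProduct

/-! ### Recognising a completion by inner regularity. -/

section Completion

theorem SigmaMeasure.ext_of_measurableSet {T : Type*} {P Q : SigmaMeasure T}
    (hsigma : P.sigma = Q.sigma)
    (hmeas : ∀ E, MeasurableSet[P.sigma] E → P.meas E = Q.meas E) : P = Q := by
  obtain ⟨m, P⟩ := P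
  obtain ⟨m', Q⟩ := Q
  obtain rfl : m = m' := hsigma
  congr
  exact Measure.ext hmeas

theorem MeasureTheory.Measure.InnerRegularWRT.exists_subset_measure_eq {T : Type*}
    {m₀ m : MeasurableSpace T} {lam : @Measure T m}
    (h : lam.InnerRegularWRT (fun B => MeasurableSet[m₀] B) (fun E => MeasurableSet[m] E))
    {E : Set T} (hE : MeasurableSet[m] E) :
    ∃ A ⊆ E, MeasurableSet[m₀] A ∧ lam A = lam E := by
  rcases eq_or_ne (lam E) 0 with h0 | h0
  · exact ⟨∅, empty_subset _, @MeasurableSet.empty _ m₀, by rw [h0, measure_empty]⟩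
  obtain ⟨u, -, hu, hlim⟩ := exists_seq_strictMono_tendsto' (pos_iff_ne_zero.2 h0)
  choose K hKE hK huK using fun n => h hE (u n) (hu n).2
  refine ⟨⋃ n, K n, iUnion_subset hKE, @MeasurableSet.iUnion _ _ m₀ _ _ hK,
    le_antisymm (measure_mono (iUnion_subset hKE)) (le_of_tendsto' hlim fun n => ?_)⟩
  exact (huK n).le.trans (measure_mono (subset_iUnion K n))

/-- A complete finite measure that is inner regular with respect to a smaller σ-algebra is the
completion of its restriction to that σ-algebra. -/
theorem SigmaMeasure.eq_completion {T : Type*} {m₀ : MeasurableSpace T} {μ : Measure T}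
    [IsFiniteMeasure μ] {m : MeasurableSpace T} {lam : @Measure T m} (hle : m₀ ≤ m)
    (hc : lam.IsComplete)
    (hr : lam.InnerRegularWRT (fun B => MeasurableSet[m₀] B) (fun E => MeasurableSet[m] E))
    (heq : ∀ B, MeasurableSet[m₀] B → lam B = μ B) :
    (⟨m, lam⟩ : SigmaMeasure T) = ⟨_, μ.completion⟩ := by
  have key (E : Set T) (hE : MeasurableSet[m] E) :
      ∃ A, MeasurableSet[m₀] A ∧ A =ᵐ[μ] E ∧ lam A = lam E := by
    -- Approximating both `E` and its complement from inside traps `E` between `A` and `A'ᶜ`, whose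
    -- difference is null.
    obtain ⟨A, hAE, hA, hlA⟩ := hr.exists_subset_measure_eq hE
    obtain ⟨A', hAE', hA', hlA'⟩ := hr.exists_subset_measure_eq hE.compl
    refine ⟨A, hA, hAE.eventuallyLE.antisymm ?_, hlA⟩
    have hlam : μ (Aᶜ \ A') = 0 := by
      have hfin' : lam A ≠ ∞ := by rw [heq A hA]; exact measure_ne_top _ _
      have hsub : A' ⊆ Aᶜ := hAE'.trans (compl_subset_compl.2 hAE)
      rw [measure_sdiff hsub hA'.nullMeasurableSet (measure_ne_top _ _), tsub_eq_zero_iff_le,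
        ← heq _ hA.compl, ← heq _ hA', hlA', measure_compl (hle _ hA) hfin', hlA,
        ← measure_compl hE (hlA ▸ hfin')]
    refine (ae_le_set (μ := μ)).2 (measure_mono_null ?_ hlam)
    exact fun x hx => ⟨hx.2, fun hxA' => hAE' hxA' hx.1⟩
  refine SigmaMeasure.ext_of_measurableSet ?_ ?_
  · ext E
    constructor
    · intro hE
      obtain ⟨A, hA, hAE, -⟩ := key E hE
      exact NullMeasurableSet.congr (m0 := m₀) (@MeasurableSet.nullMeasurableSet _ m₀ μ A hA) hAE
    · intro (hE : @NullMeasurableSet T m₀ E μ)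
      obtain ⟨A, hAE, hA, hae⟩ := hE.exists_measurable_subset_ae_eq
      -- `E \ A` has an `m₀`-measurable null hull, on which `lam` and `μ` agree; completeness then
      -- makes it measurable.
      have hnull : lam (E \ A) = 0 := by
        refine measure_mono_null (@subset_toMeasurable _ m₀ μ (E \ A)) ?_
        rw [heq _ (@measurableSet_toMeasurable _ m₀ _ _), @measure_toMeasurable _ m₀]
        exact ae_le_set.1 hae.symm.le
      have := (hle _ hA).union (hc.out _ hnull)
      rwa [union_sdiff_cancel hAE] at this
  · intro E hE
    obtain ⟨A, hA, hAE, hlA⟩ := key E hE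
    change lam E = μ E
    rw [← hlA, heq A hA, measure_congr hAE]

end Completion

/-! ### Existence and uniqueness of the τ-additive product. -/

section TauProduct

variable {Y Z : Type*} [TopologicalSpace Y] [TopologicalSpace Z]

theorem TauAdditive.ext_of_prod [MeasurableSpace (Y × Z)] [BorelSpace (Y × Z)]
    {lam lam' : Measure (Y × Z)} [IsFiniteMeasure lam] (h : TauAdditive lam)
    (h' : TauAdditive lam')
    (hprod : ∀ (U : Set Y) (V : Set Z), IsOpen U → IsOpen V → lam (U ×ˢ V) = lam' (U ×ˢ V)) :
    lam = lam' := by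
  have huniv : lam univ = lam' univ := by
    simpa using hprod univ univ isOpen_univ isOpen_univ
  let R : Set (Set (Y × Z)) := {W | ∃ U V, IsOpen U ∧ IsOpen V ∧ W = U ×ˢ V}
  have hR : IsPiSystem R := by
    rintro _ ⟨U₁, V₁, hU₁, hV₁, rfl⟩ _ ⟨U₂, V₂, hU₂, hV₂, rfl⟩ -
    exact ⟨_, _, hU₁.inter hU₂, hV₁.inter hV₂, prod_inter_prod⟩
  have hle : MeasurableSpace.generateFrom R ≤ ‹MeasurableSpace (Y × Z)› := by
    refine MeasurableSpace.generateFrom_le ?_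
    rintro _ ⟨U, V, hU, hV, rfl⟩
    exact (hU.prod hV).measurableSet
  have hgen (D : Set (Y × Z)) (hD : MeasurableSet[MeasurableSpace.generateFrom R] D) :
      lam D = lam' D := by
    refine ext_on_measurableSpace_of_generate_finite _ R ?_ hle rfl hR huniv hD
    rintro _ ⟨U, V, hU, hV, rfl⟩
    exact hprod U V hU hV
  refine ext_of_generate_finite _ (BorelSpace.measurable_eq (α := Y × Z)) isPiSystem_isOpen
    (fun W hW => ?_) huniv
  have hW : IsOpen W := hW
  -- The rectangles inside `W` need not be directed. The open subsets of `W` in the σ-algebra they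
  -- generate are closed under finite unions, and the two measures already agree on them.
  let 𝒢 : Set (Set (Y × Z)) :=
    {D | D ⊆ W ∧ IsOpen D ∧ MeasurableSet[MeasurableSpace.generateFrom R] D}
  have hunion : ⋃₀ 𝒢 = W := by
    refine Subset.antisymm (sUnion_subset fun D hD => hD.1) ?_
    rintro ⟨y, z⟩ hyz
    obtain ⟨U, V, hU, hV, hy, hz, hUV⟩ := isOpen_prod_iff.1 hW y z hyz
    exact ⟨U ×ˢ V, ⟨hUV, hU.prod hV, MeasurableSpace.measurableSet_generateFrom
      ⟨U, V, hU, hV, rfl⟩⟩, hy, hz⟩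
  have hne : 𝒢.Nonempty := ⟨∅, empty_subset _, isOpen_empty,
    @MeasurableSet.empty _ (MeasurableSpace.generateFrom R)⟩
  have hd : DirectedOn (· ⊆ ·) 𝒢 := fun D₁ h₁ D₂ h₂ =>
    ⟨D₁ ∪ D₂, ⟨union_subset h₁.1 h₂.1, h₁.2.1.union h₂.2.1, @MeasurableSet.union _ (.generateFrom R) _ _ h₁.2.2 h₂.2.2⟩,
      subset_union_left, subset_union_right⟩
  have ho : ∀ D ∈ 𝒢, IsOpen D ∧ MeasurableSet D := fun D hD =>
    ⟨hD.2.1, hD.2.1.measurableSet⟩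
  have hm : MeasurableSet (⋃₀ 𝒢) := hunion ▸ hW.measurableSet
  rw [← hunion, h 𝒢 hne hd ho hm, h' 𝒢 hne hd ho hm]
  exact biSup_congr fun D hD => hgen D hD.2.2

variable [MeasurableSpace Y] [BorelSpace Y] [MeasurableSpace Z] [BorelSpace Z]
  {μ : Measure Y} {ν : Measure Z} [IsProbabilityMeasure μ] [IsProbabilityMeasure ν]

theorem TauAdditive.isTauProduct_completion [mB : MeasurableSpace (Y × Z)]
    [hB : BorelSpace (Y × Z)] (hμ : TauAdditive μ) (hν : TauAdditive ν) :
    IsTauProduct μ ν ⟨_, (borelProd μ ν).completion⟩ := by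
  have hprob := hν.isProbabilityMeasure_borelProd (μ := μ)
  have hborel := hB.measurable_eq
  have hfin (E : Set (Y × Z)) : borelProd μ ν E < ∞ := measure_lt_top _ _
  refine ⟨?_,
    Measure.completion.isComplete _, ⟨?_, ?_⟩, ?_, ?_, ?_, ?_⟩
  · exact fun B hB => MeasurableSet.nullMeasurableSet (hborel ▸ hB)
  · exact fun E _ hE => absurd hE (hfin E).ne
  · exact fun A hA => by simpa using hA univ MeasurableSet.univ (hfin univ)
  · exact fun E _ hE => ⟨univ, isOpen_univ, MeasurableSet.univ, hfin univ, by simpa using hE⟩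
  · exact fun 𝒢 hne hd ho _ => hμ.tauAdditive_borelProd hν 𝒢 hne hd
      (fun U hU => ⟨(ho U hU).1, (ho U hU).1.measurableSet⟩)
      (isOpen_sUnion fun U hU => (ho U hU).1).measurableSet
  · intro E (hE : NullMeasurableSet E (borelProd μ ν)) r hr
    obtain ⟨A, hAE, hA, hae⟩ := hE.exists_measurable_subset_ae_eq
    refine ⟨A, hAE, hborel ▸ hA, ?_⟩
    change r < borelProd μ ν A
    rw [measure_congr hae]
    exact hr
  · exact fun U V hU hV => hν.borelProd_prod hU hV

theorem IsTauProduct.eq_completion [mB : MeasurableSpace (Y × Z)] [hB : BorelSpace (Y × Z)]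
    (hμ : TauAdditive μ) (hν : TauAdditive ν) {Q : SigmaMeasure (Y × Z)}
    (hQ : IsTauProduct μ ν Q) : Q = ⟨_, (borelProd μ ν).completion⟩ := by
  have hprob := hν.isProbabilityMeasure_borelProd (μ := μ)
  have hle : mB ≤ Q.sigma := hB.measurable_eq.trans_le hQ.topological
  have htrim : borelProd μ ν = Q.meas.trim hle := by
    refine (hμ.tauAdditive_borelProd hν).ext_of_prod ?_ fun U V hU hV => ?_
    · intro 𝒢 hne hd ho hm
      rw [trim_measurableSet_eq _ hm, hQ.tauAdditive 𝒢 hne hd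
        (fun U hU => ⟨(ho U hU).1, hle _ (ho U hU).2⟩) (hle _ hm)]
      exact biSup_congr fun U hU => (trim_measurableSet_eq _ (ho U hU).2).symm
    · rw [hν.borelProd_prod hU hV, trim_measurableSet_eq _ (hU.prod hV).measurableSet,
        hQ.rectangle U V hU hV]
  refine SigmaMeasure.eq_completion hle hQ.complete ?_ fun B hB => ?_
  · exact hB.measurable_eq ▸ hQ.innerRegular
  · rw [htrim, trim_measurableSet_eq _ hB]

theorem TauAdditive.isTauProduct_tauProd (hμ : TauAdditive μ) (hν : TauAdditive ν) :
    IsTauProduct μ ν (tauProd μ ν) := by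
  -- This overrides the default product σ-algebra, which may be strictly smaller than the Borel one.
  let _ : MeasurableSpace (Y × Z) := borel _
  have : BorelSpace (Y × Z) := ⟨rfl⟩
  exact Classical.epsilon_spec (p := IsTauProduct μ ν) ⟨_, hμ.isTauProduct_completion hν⟩

theorem IsTauProduct.eq (hμ : TauAdditive μ) (hν : TauAdditive ν) {P Q : SigmaMeasure (Y × Z)}
    (hP : IsTauProduct μ ν P) (hQ : IsTauProduct μ ν Q) : P = Q := by
  let _ : MeasurableSpace (Y × Z) := borel _
  have : BorelSpace (Y × Z) := ⟨rfl⟩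
  rw [hP.eq_completion hμ hν, hQ.eq_completion hμ hν]

end TauProduct

/-! ### Pushforward and convolution. -/

theorem TauAdditive.map {T X : Type*} [TopologicalSpace T] [TopologicalSpace X]
    [MeasurableSpace X] [OpensMeasurableSpace X] {m : MeasurableSpace T} {lam : Measure T}
    (h : TauAdditive lam) {f : T → X} (hf : Continuous f) (hfm : Measurable f) :
    TauAdditive (lam.map f) := by
  intro 𝒢 hne hd ho hm
  have := h (preimage f '' 𝒢) (hne.image _)
    (directedOn_image.2 fun U hU V hV => ?_) ?_ ?_
  · rw [Measure.map_apply hfm hm, preimage_sUnion, ← sUnion_image, this, iSup_image]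
    exact biSup_congr fun U hU => (Measure.map_apply hfm (ho U hU).2).symm
  · obtain ⟨W, hW, h₁, h₂⟩ := hd U hU V hV
    exact ⟨W, hW, preimage_mono h₁, preimage_mono h₂⟩
  · rintro _ ⟨U, hU, rfl⟩
    exact ⟨(ho U hU).1.preimage hf, hfm (ho U hU).2⟩
  · rw [sUnion_image, ← preimage_sUnion]
    exact hfm hm

theorem mainTheorem4 {G X : Type*} [Group G] [TopologicalSpace G] [IsTopologicalGroup G]
    [MeasurableSpace G] [BorelSpace G] [TopologicalSpace X] [MeasurableSpace X] [BorelSpace X]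
    [MulAction G X] [ContinuousSMul G X]
    (μ : Measure G) (hμ : μ ∈ MTau G) (ν : Measure X) (hν : ν ∈ MTau X) :
    -- the product measure `μ × ν` exists and is the only one with its defining properties
    (IsTauProduct μ ν (tauProd μ ν) ∧
      ∀ Q : SigmaMeasure (G × X), IsTauProduct μ ν Q → Q = tauProd μ ν) ∧
    -- `π⁻¹[E]` belongs to the domain of `μ × ν` for every Borel set `E`
    (∀ E : Set X, MeasurableSet E →
      MeasurableSet[(tauProd μ ν).sigma] ((fun p : G × X => p.1 • p.2) ⁻¹' E)) ∧
    -- `μ ∗ ν` is a (unique) τ-additive Borel probability measure on `X`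
    ∃! κ : Measure X, κ ∈ MTau X ∧ ∀ E : Set X, MeasurableSet E → κ E = tauConv μ ν E := by
  obtain ⟨hμp, hμ⟩ := hμ
  obtain ⟨hνp, hν⟩ := hν
  have hP := hμ.isTauProduct_tauProd hν
  have hcont : Continuous fun p : G × X => p.1 • p.2 := continuous_smul
  have hmeas : @Measurable _ _ (tauProd μ ν).sigma _ fun p : G × X => p.1 • p.2 := by
    refine Measurable.mono (ma := borel (G × X)) ?_ hP.topological le_rfl
    rw [BorelSpace.measurable_eq (α := X)]
    exact hcont.borel_measurable
  have happly (E : Set X) (hE : MeasurableSet E) :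
      @Measure.map _ _ (tauProd μ ν).sigma _ (fun p : G × X => p.1 • p.2) (tauProd μ ν).meas E = tauConv μ ν E :=
    @Measure.map_apply _ _ (tauProd μ ν).sigma _ _ _ hmeas _ hE
  -- The witness left to unification is the pushforward of the product under the action.
  refine ⟨⟨hP, fun Q hQ => hQ.eq hμ hν hP⟩, fun E hE => hmeas hE, _,
    ⟨⟨⟨?_⟩, hP.tauAdditive.map hcont hmeas⟩, happly⟩, ?_⟩
  · rw [happly _ MeasurableSet.univ, tauConv, preimage_univ, ← univ_prod_univ,
      hP.rectangle _ _ isOpen_univ isOpen_univ, measure_univ, measure_univ, one_mul]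
  · rintro κ ⟨-, hκ⟩
    exact Measure.ext fun E hE => (hκ E hE).trans (happly E hE).symm
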